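/- Let $A$ be a unital associative ring. "$A$-module" means left $A$-module, and $A^{\mathrm{op}}$ denotes the opposite ring. An $A$-module $M$ is *cotorsion* if $\operatorname{Ext}^1_A(F,M)=0$ for every flat $A$-module $F$, and *flat-cotorsion* if it is both flat and cotorsion. An $A$-module $G$ is *Gorenstein flat-cotorsion* if there is an acyclic complex $F=(\cdots\to F_1\to F_0\to F_{-1}\to\cdots)$ of flat-cotorsion $A$-modules such that $\operatorname{Hom}_A(F,C)$ is acyclic for every flat-cotorsion $A$-module $C$ and $\operatorname{Coker}(F_1\to F_0)\cong G$. *Gorenstein projective* modules are defined in the same way, with "flat-cotorsion" replaced by "projective" throughout. The Gorenstein projective dimension $\operatorname{Gpd}_A M\in\{0,1,2,\dots,\infty\}$ is the least $n\ge 0$ for which there is an exact sequence $0\to G_n\to\cdots\to G_0\to M\to 0$ with every $G_i$ Gorenstein projective ($\infty$ if there is none), and the *Gorenstein global dimension* of $A$ is $$\operatorname{Ggldim}(A)=\sup\{\operatorname{Gpd}_A M \mid M \text{ is an } A\text{-module}\}.$$ The ring $A$ is *Quasi-Frobenius* if every projective $A$-module is injective. **Theorem.** The following conditions are equivalent. 1.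 $\operatorname{Ggldim}(A)=0$. 2. $\operatorname{Ggldim}(A^{\mathrm{op}})=0$. 3. Every $A$-module is Gorenstein flat-cotorsion. 4. Every $A^{\mathrm{op}}$-module is Gorenstein flat-cotorsion. 5. $A$ is Quasi-Frobenius. -/

import Mathlib

open CategoryTheory CategoryTheory.Limits
open scoped TensorProduct

universe u

/-! ### Tensor products and flatness over a possibly noncommutative ring

Left modules over `A` are `A`-modules; right modules over `A` are `Aᵐᵒᵖ`-modules, with
`x * a` written as `MulOpposite.op a • x`. -/

section Flat

variable (A : Type u) [Ring A]

/-- The subgroup of `N ⊗[ℤ] M` generated by the elements `xa ⊗ m - x ⊗ am`. -/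
def balancedRelations (N : Type u) [AddCommGroup N] [Module Aᵐᵒᵖ N]
    (M : Type u) [AddCommGroup M] [Module A M] : AddSubgroup (N ⊗[ℤ] M) :=
  AddSubgroup.closure {t | ∃ (x : N) (a : A) (m : M),
    t = (MulOpposite.op a • x) ⊗ₜ[ℤ] m - x ⊗ₜ[ℤ] (a • m)}

/-- The tensor product (an abelian group) of a right `A`-module `N` and a left `A`-module `M`. -/
abbrev BalancedTensor (N : Type u) [AddCommGroup N] [Module Aᵐᵒᵖ N]
    (M : Type u) [AddCommGroup M] [Module A M] : Type u :=
  (N ⊗[ℤ] M) ⧸ balancedRelations A N M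

/-- The map `N ⊗ M → N' ⊗ M` of tensor products over `A` induced by a homomorphism `N → N'` of
right `A`-modules. -/
def BalancedTensor.map {N N' : Type u} [AddCommGroup N] [Module Aᵐᵒᵖ N]
    [AddCommGroup N'] [Module Aᵐᵒᵖ N'] (f : N →ₗ[Aᵐᵒᵖ] N')
    (M : Type u) [AddCommGroup M] [Module A M] :
    BalancedTensor A N M →+ BalancedTensor A N' M :=
  QuotientAddGroup.map _ _
    (LinearMap.rTensor M f.toAddMonoidHom.toIntLinearMap).toAddMonoidHom (by
      refine (AddSubgroup.closure_le _).2 ?_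
      rintro _ ⟨x, a, m, rfl⟩
      refine AddSubgroup.subset_closure ⟨f x, a, m, ?_⟩
      rw [map_sub]
      exact congrArg (fun y : N' => y ⊗ₜ[ℤ] m - f x ⊗ₜ[ℤ] (a • m)) (f.map_smul _ x))

/-- A left `A`-module is flat if tensoring with it preserves injectivity of homomorphisms of right
`A`-modules. -/
def IsFlatModule (M : ModuleCat.{u} A) : Prop :=
  ∀ (N N' : Type u) [AddCommGroup N] [Module Aᵐᵒᵖ N] [AddCommGroup N'] [Module Aᵐᵒᵖ N']
    (f : N →ₗ[Aᵐᵒᵖ] N'),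
    Function.Injective f → Function.Injective (BalancedTensor.map A f M)

end Flat

section Gorenstein

variable {A : Type u} [Ring A]

/-- An `A`-module `M` is cotorsion if `Ext¹(F, M) = 0` for every flat `A`-module `F`. -/
def IsCotorsionModule (M : ModuleCat.{u} A) : Prop :=
  ∀ F : ModuleCat.{u} A, IsFlatModule A F → Subsingleton (Abelian.Ext F M 1)

/-- A module is flat-cotorsion if it is both flat and cotorsion. -/
def IsFlatCotorsion (M : ModuleCat.{u} A) : Prop :=
  IsFlatModule A M ∧ IsCotorsionModule M

/-- The complex of abelian groups `Hom(F, C)`. -/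
noncomputable def homComplex (F : ChainComplex (ModuleCat.{u} A) ℤ) (C : ModuleCat.{u} A) :
    HomologicalComplex AddCommGrpCat.{u} (ComplexShape.down ℤ).symm :=
  ((preadditiveYoneda.obj C).mapHomologicalComplex _).obj F.op

/-- For a class `P` of modules, `F` is a totally acyclic complex of modules from `P`: it is acyclic,
and `Hom(F, C)` is acyclic for every `C` in `P`. -/
structure IsTotallyAcyclic (P : ModuleCat.{u} A → Prop)
    (F : ChainComplex (ModuleCat.{u} A) ℤ) : Prop where
  mem : ∀ n : ℤ, P (F.X n)
  acyclic : F.Acyclic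
  hom_acyclic : ∀ C : ModuleCat.{u} A, P C → (homComplex F C).Acyclic

/-- `G` is isomorphic to the cokernel of `F₁ ⟶ F₀` for a totally acyclic complex `F` of
modules from `P`. -/
def IsGorensteinFor (P : ModuleCat.{u} A → Prop) (G : ModuleCat.{u} A) : Prop :=
  ∃ F : ChainComplex (ModuleCat.{u} A) ℤ,
    IsTotallyAcyclic P F ∧ Nonempty (cokernel (F.d 1 0) ≅ G)

/-- Gorenstein flat-cotorsion modules. -/
def IsGorensteinFlatCotorsion (G : ModuleCat.{u} A) : Prop :=
  IsGorensteinFor IsFlatCotorsion G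

/-- Gorenstein projective modules. -/
def IsGorensteinProjective (G : ModuleCat.{u} A) : Prop :=
  IsGorensteinFor (fun P => Projective P) G

/-- `M` has a resolution `0 → Gₙ → ⋯ → G₀ → M → 0` by Gorenstein projective modules. -/
def HasGorensteinProjectiveResolution (M : ModuleCat.{u} A) (n : ℕ) : Prop :=
  ∃ (G : ChainComplex (ModuleCat.{u} A) ℕ)
    (π : G ⟶ (ChainComplex.single₀ (ModuleCat.{u} A)).obj M),
    (∀ i, IsGorensteinProjective (G.X i)) ∧ (∀ i, n < i → IsZero (G.X i)) ∧ QuasiIso π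

/-- The Gorenstein projective dimension of `M`, the least `n` such that `M` has a Gorenstein
projective resolution of length `n`, and `⊤` if there is none. -/
noncomputable def gorensteinProjectiveDim (M : ModuleCat.{u} A) : ℕ∞ :=
  ⨅ (n : ℕ) (_ : HasGorensteinProjectiveResolution M n), (n : ℕ∞)

end Gorenstein

section Ring

variable (A : Type u) [Ring A]

/-- The Gorenstein global dimension of `A`. -/
noncomputable def gorensteinGlobalDim : ℕ∞ :=
  ⨆ M : ModuleCat.{u} A, gorensteinProjectiveDim M

/-- A ring is Quasi-Frobenius if its projective modules are injective. -/
def IsQuasiFrobenius : Prop :=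
  ∀ P : ModuleCat.{u} A, Projective P → Injective P

end Ring

/-!
# Quasi-Frobenius rings through Gorenstein modules

**From Gorenstein conditions to Quasi-Frobenius.** If `G` is Gorenstein for a class `P` of modules
with `Ext¹(F, C) = 0` for all `F` and `C` in `P`, then `Ext¹(G, C) = 0` for `C` in `P`
(`IsGorensteinFor.subsingleton_ext`). So if every module is Gorenstein for `P`, then every member
of `P` is injective. For the projective modules this says that `A` is Quasi-Frobenius; for the
flat-cotorsion modules a projective module is a direct summand of a flat-cotorsion, hence
injective, module of which it is a quotient.

**From Quasi-Frobenius to Gorenstein conditions.** `A` is Quasi-Frobenius if and only if it is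
left Noetherian and left self-injective (`isQuasiFrobenius_iff`). For such a ring every module
embeds into a free module (`Module.Baer.exists_injective_finsupp`), so injective and projective
modules agree, and flat modules are injective because homomorphisms from finitely presented
modules to flat modules factor through free modules of finite rank (`IsFlatModule.baer`). Hence
flat-cotorsion modules are the projective modules, and splicing projective and injective
resolutions of any module gives a totally acyclic complex.

**Noetherianity.** This is Faith's theorem. Let `J` be the radical of `A`. Injectivity of the free
module of countable rank gives the ascending chain condition on left annihilators
(`accLeftAnn_of_baer_finsupp`). A principal right ideal `x * A` is the right annihilator of the
left annihilator of `x`, so principal right ideals satisfy the descending chain condition; it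
follows that `A ⧸ J` is semisimple (`ACCLeftAnn.exists_sub_one_mem`) and that `J` is nilpotent.
The main point is that every simple module embeds into `A`, equivalently that the socle `S` of the
left module `A` has annihilator `J`. The map sending a two-sided ideal `K ⊇ J` to the annihilator
of `S * K` is injective and reverses inclusions; by the chain condition its square then fixes the
least such ideal `J`, and `J` is mapped to `A`, which is mapped to the annihilator of `S`
(`ACCLeftAnn.leftAnn_radAnn`). Now `A` is an injective cogenerator, so every left ideal is a left
annihilator and the chain condition gives Noetherianity.

**Symmetry.** A left Noetherian left self-injective ring is left Artinian by the Hopkins–Levitzki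
theorem. Since `A` is an injective cogenerator, both properties pass to the opposite ring
(`isNoetherianRing_and_baer_of_antiEquiv`).
-/

/-! ### Rings with the ascending chain condition on left annihilators -/

section InjectiveRing

variable {A : Type u} [Ring A]

/-- A map to an injective module factors through every map with smaller kernel. -/
theorem Module.Baer.exists_factor {N : Type*} [AddCommGroup N] [Module A N] (hN : Module.Baer A N)
    {M M' : Type*} [AddCommGroup M] [Module A M] [AddCommGroup M'] [Module A M']
    (g : M →ₗ[A] M') (h : M →ₗ[A] N) (hgh : LinearMap.ker g ≤ LinearMap.ker h) :
    ∃ h' : M' →ₗ[A] N, ∀ x, h' (g x) = h x := by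
  obtain ⟨h', hh'⟩ := hN.extension_property ((LinearMap.ker g).liftQ g le_rfl)
    (LinearMap.ker_eq_bot.1 (Submodule.ker_liftQ_eq_bot _ _ _ le_rfl))
    ((LinearMap.ker g).liftQ h hgh)
  exact ⟨h', fun x => LinearMap.congr_fun hh' (Submodule.Quotient.mk x)⟩

/-- The left ideal of all `a` with `a * x = 0` for every `x ∈ X`. -/
def leftAnn (X : Set A) : Ideal A where
  carrier := {a | ∀ x ∈ X, a * x = 0}
  add_mem' ha hb x hx := by rw [add_mul, ha x hx, hb x hx, add_zero]
  zero_mem' x _ := zero_mul x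
  smul_mem' c a ha x hx := by rw [smul_eq_mul, mul_assoc, ha x hx, mul_zero]

theorem mem_leftAnn {X : Set A} {a : A} : a ∈ leftAnn X ↔ ∀ x ∈ X, a * x = 0 := Iff.rfl

theorem mem_leftAnn_singleton {x a : A} : a ∈ leftAnn {x} ↔ a * x = 0 := by
  simp [mem_leftAnn]

theorem leftAnn_le_leftAnn_mul (x c : A) : leftAnn {x} ≤ leftAnn {x * c} := fun a ha => by
  rw [mem_leftAnn_singleton] at ha ⊢
  rw [← mul_assoc, ha, zero_mul]

/-- In a left self-injective ring a finitely generated right ideal is the right annihilator of its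
left annihilator. -/
theorem Module.Baer.exists_eq_sum_mul (hA : Module.Baer A A) {ι : Type*} [Fintype ι] (x : ι → A)
    (b : A) (h : ∀ a, (∀ i, a * x i = 0) → a * b = 0) : ∃ c : ι → A, b = ∑ i, x i * c i := by
  classical
  obtain ⟨f, hf⟩ := hA.exists_factor
    (LinearMap.pi fun i => LinearMap.toSpanSingleton A A (x i)) (LinearMap.toSpanSingleton A A b)
    (fun a ha => by
      simp only [LinearMap.mem_ker, LinearMap.toSpanSingleton_apply, smul_eq_mul] at ha ⊢
      exact h a fun i => by simpa using congrFun ha i)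
  refine ⟨fun i => f (Pi.single i 1), ?_⟩
  have h1 := hf 1
  rw [LinearMap.pi_apply_eq_sum_univ f] at h1
  have h2 : ∀ i : ι, (fun j => if i = j then (1 : A) else 0) = Pi.single i 1 := fun i => by
    ext j
    by_cases hij : i = j
    · subst hij; simp
    · simp [hij, Ne.symm hij]
  simp only [h2] at h1
  simpa using h1.symm

theorem Module.Baer.exists_eq_mul (hA : Module.Baer A A) {x b : A}
    (h : leftAnn {x} ≤ leftAnn {b}) : ∃ c, b = x * c := by
  obtain ⟨c, hc⟩ := hA.exists_eq_sum_mul (fun _ : Unit => x) b fun a ha =>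
    mem_leftAnn_singleton.1 (h (mem_leftAnn_singleton.2 (ha ())))
  exact ⟨c (), by simpa using hc⟩

variable (A) in
/-- The ascending chain condition on left ideals of the form `leftAnn X`. -/
def ACCLeftAnn : Prop := WellFounded fun X Y : Set A => leftAnn Y < leftAnn X

/-- A strictly increasing chain `leftAnn (X n)` would give elements `x n ∈ X n` such that
`a ↦ (a * x n)ₙ` maps the union of the chain to finitely supported sequences; an extension of this
map to `A` is right multiplication by a single finitely supported sequence. -/
theorem accLeftAnn_of_baer_finsupp (h : Module.Baer A (ℕ →₀ A)) : ACCLeftAnn A := by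
  classical
  refine wellFounded_iff_isEmpty_descending_chain.2 ⟨fun ⟨X, hX⟩ => ?_⟩
  have hmono : Monotone fun n => leftAnn (X n) := monotone_nat_of_le_succ fun n => (hX n).le
  have hx : ∀ n, ∃ x ∈ X n, ∃ a ∈ leftAnn (X (n + 1)), a * x ≠ 0 := fun n => by
    obtain ⟨a, ha, ha'⟩ := SetLike.exists_of_lt (hX n)
    rw [mem_leftAnn] at ha'
    push Not at ha'
    obtain ⟨x, hx, hax⟩ := ha'
    exact ⟨x, hx, a, ha, hax⟩
  choose x hxX a ha hax using hx
  let I : Ideal A := ⨆ n, leftAnn (X n)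
  have hI : ∀ {c}, c ∈ I ↔ ∃ n, c ∈ leftAnn (X n) := fun {c} =>
    Submodule.mem_iSup_of_directed _ hmono.directed_le
  have hfin : ∀ c : I, (Function.support fun n => (c : A) * x n).Finite := fun c => by
    obtain ⟨n, hn⟩ := hI.1 c.2
    refine (Set.finite_lt_nat n).subset fun k hk => ?_
    by_contra hkn
    exact hk (hmono (not_lt.1 hkn) hn _ (hxX k))
  let f : I →ₗ[A] (ℕ →₀ A) :=
    { toFun := fun c => Finsupp.ofSupportFinite _ (hfin c)
      map_add' := fun c d => Finsupp.ext fun n => add_mul (c : A) d (x n)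
      map_smul' := fun c d => Finsupp.ext fun n => mul_assoc c (d : A) (x n) }
  obtain ⟨g, hg⟩ := h I f
  obtain ⟨n, hn⟩ : ∃ n, g 1 n = 0 := by
    obtain ⟨n, hn⟩ := Infinite.exists_notMem_finset (g 1).support
    exact ⟨n, Finsupp.notMem_support_iff.1 hn⟩
  have hmem : a n ∈ I := hI.2 ⟨_, ha n⟩
  refine hax n ?_
  calc a n * x n = f ⟨a n, hmem⟩ n := rfl
    _ = g (a n • 1) n := by rw [← hg _ hmem, smul_eq_mul, mul_one]
    _ = 0 := by rw [map_smul, Finsupp.smul_apply, hn, smul_zero]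

/-- Among the elements satisfying `P` there is one, `b`, such that `b ∈ b * c * A` whenever
`P (b * c)`. -/
theorem ACCLeftAnn.exists_minimal (hacc : ACCLeftAnn A) (hA : Module.Baer A A) (P : A → Prop)
    {b₀ : A} (h₀ : P b₀) : ∃ b, P b ∧ ∀ c, P (b * c) → ∃ d, b = b * c * d := by
  obtain ⟨_, ⟨b, hb, rfl⟩, hmin⟩ := hacc.has_min {X | ∃ b, P b ∧ X = {b}} ⟨_, b₀, h₀, rfl⟩
  refine ⟨b, hb, fun c hc => hA.exists_eq_mul ?_⟩
  by_contra hle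
  exact hmin _ ⟨_, hc, rfl⟩ (lt_of_le_not_ge (leftAnn_le_leftAnn_mul b c) hle)

/-- One-sided inverses are two-sided: the right ideals `y ^ n * A` become stationary. -/
theorem ACCLeftAnn.mul_eq_one_symm (hacc : ACCLeftAnn A) (hA : Module.Baer A A) {x y : A}
    (h : x * y = 1) : y * x = 1 := by
  obtain ⟨_, ⟨n, rfl⟩, hn⟩ := hacc.exists_minimal hA (fun b => ∃ n : ℕ, b = y ^ n) ⟨0, rfl⟩
  obtain ⟨d, hd⟩ := hn y ⟨n + 1, (pow_succ y n).symm⟩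
  have hxy : x ^ n * y ^ n = 1 := by
    clear hn hd
    induction n with
    | zero => simp
    | succ n ih => rw [pow_succ, pow_succ', mul_assoc, ← mul_assoc x, h, one_mul, ih]
  have hyd : y * d = 1 := by
    calc y * d = x ^ n * y ^ n * (y * d) := by rw [hxy, one_mul]
      _ = x ^ n * (y ^ n * y * d) := by simp only [mul_assoc]
      _ = 1 := by rw [← hd, hxy]
  have : x = d := by rw [← mul_one x, ← hyd, ← mul_assoc, h, one_mul]
  rwa [this]

/-- The Jacobson radical contains every left ideal of elements `x` such that each `1 - x` is right
invertible, because right invertible elements are units here. -/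
theorem ACCLeftAnn.mem_jacobson (hacc : ACCLeftAnn A) (hA : Module.Baer A A) {x : A}
    (h : ∀ y, ∃ z, (1 - y * x) * z = 1) : x ∈ Ring.jacobson A := by
  rw [← Ideal.jacobson_bot, Ideal.mem_jacobson_iff]
  intro y
  obtain ⟨z, hz⟩ := h (-y)
  have := hacc.mul_eq_one_symm hA hz
  refine ⟨z, ?_⟩
  rw [Ideal.mem_bot, ← this]
  noncomm_ring

theorem exists_mul_eq_one_of_mem_jacobson {x : A} (h : x ∈ Ring.jacobson A) :
    ∃ z, z * (1 - x) = 1 := by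
  rw [← Ideal.jacobson_bot, Ideal.mem_jacobson_iff] at h
  obtain ⟨z, hz⟩ := h (-1)
  refine ⟨z, ?_⟩
  rw [Ideal.mem_bot] at hz
  rw [← sub_eq_zero, ← hz]
  noncomm_ring

theorem jacobson_le_of_isMaximal {m : Ideal A} (hm : m.IsMaximal) : Ring.jacobson A ≤ m := by
  rw [← Ideal.jacobson_bot]
  exact sInf_le ⟨bot_le, hm⟩

/-- Modulo the Jacobson radical every left ideal `K` is generated by the idempotent `1 - b`. Here
`b` is chosen in `1 + K` with `b * A` minimal; since `b * (1 + K) ⊆ 1 + K`, this forces `b ∈ b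
* c * A` for all `c ∈ 1 + K`. -/
theorem ACCLeftAnn.exists_sub_one_mem (hacc : ACCLeftAnn A) (hA : Module.Baer A A) (K : Ideal A) :
    ∃ b, b - 1 ∈ K ∧ ∀ x ∈ K, x * b ∈ Ring.jacobson A := by
  obtain ⟨b, hb, hmin⟩ := hacc.exists_minimal hA (fun b => b - 1 ∈ K) (b₀ := 1) (by simp)
  have hxb : ∀ x ∈ K, x * b ∈ K := fun x hx => by
    have := K.add_mem hx (K.mul_mem_left x hb)
    rwa [mul_sub, mul_one, add_sub_cancel] at this
  have key : ∀ x ∈ K, ∃ z, (1 - x * b) * z = 1 := fun x hx => by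
    obtain ⟨d, hd⟩ := hmin (1 - x * b) (by
      have : b * (1 - x * b) - 1 = (b - 1) - b * (x * b) := by noncomm_ring
      rw [this]
      exact K.sub_mem hb (K.mul_mem_left b (hxb x hx)))
    have hd' : (1 - b * x) * (b * d) = b := by
      rw [← mul_assoc]
      nth_rw 3 [hd]
      noncomm_ring
    -- `1 - b * x` is right invertible, hence so is `1 - x * b`.
    refine ⟨1 + x * (1 + b * d * x) * b, ?_⟩
    calc (1 - x * b) * (1 + x * (1 + b * d * x) * b)
        = 1 - x * b + x * (1 - b * x) * b + x * ((1 - b * x) * (b * d)) * x * b := by noncomm_ring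
      _ = 1 := by rw [hd']; noncomm_ring
  refine ⟨b, hb, fun x hx => hacc.mem_jacobson hA fun y => ?_⟩
  obtain ⟨z, hz⟩ := key (y * x) (K.mul_mem_left y hx)
  exact ⟨z, by rwa [← mul_assoc]⟩

theorem ACCLeftAnn.eq_zero_of_eq_mul (hacc : ACCLeftAnn A) (hA : Module.Baer A A) {p x : A}
    (hx : x ∈ Ring.jacobson A) (h : p = p * x) : p = 0 := by
  obtain ⟨z, hz⟩ := exists_mul_eq_one_of_mem_jacobson hx
  have hz' := hacc.mul_eq_one_symm hA hz
  calc p = p * ((1 - x) * z) := by rw [hz', mul_one]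
    _ = (p - p * x) * z := by noncomm_ring
    _ = 0 := by rw [← h, sub_self, zero_mul]

/-- The annihilators of the powers of the radical `J` become stationary, say at `J ^ k`. If
`J ^ k ≠ 0`, choose `p` outside the annihilator of `J ^ k` with `p * A` minimal; then `p * J`
annihilates `J ^ k`, so `p` annihilates `J ^ (k + 1)`. -/
theorem ACCLeftAnn.isNilpotent_jacobson (hacc : ACCLeftAnn A) (hA : Module.Baer A A) :
    IsNilpotent (Ring.jacobson A) := by
  set J := Ring.jacobson A with hJ
  obtain ⟨_, ⟨k, rfl⟩, hmin⟩ := hacc.has_min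
    {X | ∃ k : ℕ, X = ((J ^ k : Ideal A) : Set A)} ⟨_, 0, rfl⟩
  refine ⟨k, ?_⟩
  by_contra hk
  have h1 : (1 : A) ∉ leftAnn ((J ^ k : Ideal A) : Set A) := fun h => hk <| by
    rw [Ideal.zero_eq_bot, eq_bot_iff]
    exact fun x hx => by simpa using h x hx
  obtain ⟨p, hp, hpmin⟩ := hacc.exists_minimal hA
    (fun p => p ∉ leftAnn ((J ^ k : Ideal A) : Set A)) h1
  have hpj : ∀ j ∈ J, p * j ∈ leftAnn ((J ^ k : Ideal A) : Set A) := fun j hj => by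
    by_contra hP
    obtain ⟨d, hd⟩ := hpmin j hP
    rw [mul_assoc] at hd
    have := hacc.eq_zero_of_eq_mul hA (J.mul_mem_right d hj) hd
    exact hp (this ▸ Ideal.zero_mem _)
  have hpk : p ∈ leftAnn ((J ^ (k + 1) : Ideal A) : Set A) := fun x hx => by
    rw [SetLike.mem_coe, Ideal.IsTwoSided.pow_succ] at hx
    refine Submodule.smul_induction_on hx (fun j hj y hy => ?_) fun x y hx hy => ?_
    · rw [smul_eq_mul, ← mul_assoc]
      exact hpj j hj y hy
    · rw [mul_add, hx, hy, add_zero]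
  refine hmin _ ⟨k + 1, rfl⟩ (lt_of_le_of_ne (fun a ha x hx => ha x ?_) fun h => ?_)
  · rw [SetLike.mem_coe, Ideal.IsTwoSided.pow_succ] at hx
    exact Ideal.mul_le_right hx
  · exact hp (h ▸ hpk)

theorem ACCLeftAnn.isSemiprimaryRing (hacc : ACCLeftAnn A) (hA : Module.Baer A A) :
    IsSemiprimaryRing A := by
  refine ⟨(isSemisimpleModule_iff _ _).2 ⟨fun K' => ?_⟩, hacc.isNilpotent_jacobson hA⟩
  set q := Ideal.Quotient.mk (Ring.jacobson A) with hq
  let K : Ideal A := Ideal.comap q K'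
  obtain ⟨b, hb, hKb⟩ := hacc.exists_sub_one_mem hA K
  refine ⟨Ideal.span {q b}, ?_, ?_⟩
  · rw [disjoint_iff, eq_bot_iff]
    rintro x ⟨hxK, hx⟩
    obtain ⟨a, rfl⟩ := Ideal.mem_span_singleton'.1 hx
    obtain ⟨a, rfl⟩ := Ideal.Quotient.mk_surjective a
    have hab : a * b ∈ K := by simpa [K, hq] using hxK
    have ha : a ∈ K := by
      have := K.sub_mem hab (K.mul_mem_left a hb)
      rwa [mul_sub, mul_one, sub_sub_cancel] at this
    rw [Submodule.mem_bot, ← map_mul]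
    exact Ideal.Quotient.eq_zero_iff_mem.2 (hKb a ha)
  · rw [codisjoint_iff, Ideal.eq_top_iff_one]
    refine Submodule.mem_sup.2 ⟨q (1 - b), ?_, q b, Ideal.subset_span rfl, by simp⟩
    have : 1 - b ∈ K := by rw [← neg_sub]; exact K.neg_mem hb
    exact this

variable (A) in
/-- The elements annihilated on the left by the Jacobson radical. When `A` is semilocal they form
the socle of the left module `A`. -/
def radAnn : Set A := {s | ∀ j ∈ Ring.jacobson A, j * s = 0}

theorem mul_mem_radAnn_left {s : A} (hs : s ∈ radAnn A) (c : A) : c * s ∈ radAnn A :=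
  fun j hj => by
  rw [← mul_assoc]
  exact hs _ (Ideal.mul_mem_right c _ hj)

theorem mul_mem_radAnn_right {s : A} (hs : s ∈ radAnn A) (c : A) : s * c ∈ radAnn A :=
  fun j hj => by rw [← mul_assoc, hs j hj, zero_mul]

theorem ne_zero_of_leftAnn_ne_top {x : A} : leftAnn {x} ≠ ⊤ ↔ x ≠ 0 := by
  rw [Ne, Ne, Ideal.eq_top_iff_one, mem_leftAnn_singleton, one_mul]

/-- A nonzero element of the socle has a multiple generating a simple left ideal. -/
theorem ACCLeftAnn.exists_isMaximal_leftAnn (hacc : ACCLeftAnn A) (hA : Module.Baer A A) {x : A}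
    (hx : x ∈ radAnn A) (hx0 : x ≠ 0) : ∃ b, (leftAnn {b * x}).IsMaximal := by
  obtain ⟨m, hm, hxm⟩ := Ideal.exists_le_maximal _ (ne_zero_of_leftAnn_ne_top.2 hx0)
  obtain ⟨b, hb, hmb⟩ := hacc.exists_sub_one_mem hA m
  refine ⟨b, ?_⟩
  have hle : m ≤ leftAnn {b * x} := fun a ha => by
    rw [mem_leftAnn_singleton, ← mul_assoc]
    exact hx _ (hmb a ha)
  rwa [← hm.eq_of_le (ne_zero_of_leftAnn_ne_top.2 fun h => hm.ne_top ?_) hle]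
  have := m.sub_mem (hxm (mem_leftAnn_singleton.2 h)) hb
  rwa [sub_sub_cancel, ← Ideal.eq_top_iff_one] at this

theorem Module.Baer.exists_eq_mul_of_isMaximal (hA : Module.Baer A A) {t x : A}
    (ht : (leftAnn {t}).IsMaximal) (h : leftAnn {t} ≤ leftAnn {x}) (hx : x ≠ 0) :
    ∃ b, t = x * b :=
  hA.exists_eq_mul (ht.eq_of_le (ne_zero_of_leftAnn_ne_top.2 hx) h).ge

/-- If `s * j ≠ 0`, then `s` has a multiple `s'` such that right multiplication by `j` is injective
on `A * s'`. Then `s'` lies in `s' * j * A`, which is impossible for `j` in the radical. -/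
theorem ACCLeftAnn.radAnn_mul_jacobson (hacc : ACCLeftAnn A) (hA : Module.Baer A A) {s j : A}
    (hs : s ∈ radAnn A) (hj : j ∈ Ring.jacobson A) : s * j = 0 := by
  by_contra hsj
  obtain ⟨b, hm⟩ := hacc.exists_isMaximal_leftAnn hA (mul_mem_radAnn_right hs j) hsj
  obtain ⟨g, hg, hmg⟩ := hacc.exists_sub_one_mem hA (leftAnn {b * (s * j)})
  have hgt : g * (b * s) * j = b * (s * j) := by
    rw [mem_leftAnn_singleton, sub_mul, one_mul, sub_eq_zero] at hg
    simpa only [mul_assoc] using hg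
  have ht0 : b * (s * j) ≠ 0 := ne_zero_of_leftAnn_ne_top.1 hm.ne_top
  have hle : leftAnn {b * (s * j)} ≤ leftAnn {g * (b * s)} := fun a ha => by
    rw [mem_leftAnn_singleton, ← mul_assoc]
    exact mul_mem_radAnn_left hs b _ (hmg a ha)
  obtain ⟨d, hd⟩ := hA.exists_eq_mul hle
  rw [← hgt, mul_assoc (g * (b * s))] at hd
  have := hacc.eq_zero_of_eq_mul hA (Ideal.mul_mem_right d _ hj) hd
  rw [this, zero_mul] at hgt
  exact ht0 hgt.symm

/-- The socle is an essential left ideal. -/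
theorem ACCLeftAnn.exists_mul_mem_radAnn (hacc : ACCLeftAnn A) (hA : Module.Baer A A) {c : A}
    (hc : c ≠ 0) : ∃ d, d * c ∈ radAnn A ∧ d * c ≠ 0 := by
  classical
  have hex : ∃ n : ℕ, ∀ y ∈ Ring.jacobson A ^ n, y * c = 0 := by
    obtain ⟨n, hn⟩ := hacc.isNilpotent_jacobson hA
    refine ⟨n, fun y hy => ?_⟩
    rw [hn, Ideal.zero_eq_bot, Ideal.mem_bot] at hy
    rw [hy, zero_mul]
  have hspec := Nat.find_spec hex
  rcases hn : Nat.find hex with _ | n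
  · rw [hn] at hspec
    exact absurd (by simpa using hspec 1 (by simp [Submodule.pow_zero])) hc
  · rw [hn] at hspec
    have := Nat.find_min hex (m := n) (by omega)
    push Not at this
    obtain ⟨y, hy, hyc⟩ := this
    refine ⟨y, fun j hj => ?_, hyc⟩
    rw [← mul_assoc]
    exact hspec _ (by rw [Ideal.IsTwoSided.pow_succ]; exact Ideal.mul_mem_mul hj hy)

theorem ACCLeftAnn.mem_jacobson_of_radAnn_mul (hacc : ACCLeftAnn A) (hA : Module.Baer A A) {a : A}
    (ha : ∀ s ∈ radAnn A, s * a = 0) : a ∈ Ring.jacobson A := by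
  refine hacc.mem_jacobson hA fun y => ?_
  obtain ⟨z, hz⟩ := hA.exists_eq_mul (x := 1 - y * a) (b := 1) fun c hc => by
    rw [mem_leftAnn_singleton] at hc ⊢
    rw [mul_one]
    by_contra hc0
    obtain ⟨d, hd, hd0⟩ := hacc.exists_mul_mem_radAnn hA hc0
    apply hd0
    calc d * c = d * c * y * a + d * (c * (1 - y * a)) := by noncomm_ring
      _ = 0 := by rw [ha _ (mul_mem_radAnn_right hd y), hc, mul_zero, add_zero]
  exact ⟨z, hz.symm⟩

/-- The left annihilator of `S * K`, where `S = radAnn A` is the socle. -/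
def annSocleMul (K : Ideal A) : Ideal A := leftAnn {x | ∃ s ∈ radAnn A, ∃ k ∈ K, x = s * k}

theorem mem_annSocleMul {K : Ideal A} {a : A} :
    a ∈ annSocleMul K ↔ ∀ s ∈ radAnn A, ∀ k ∈ K, a * (s * k) = 0 :=
  ⟨fun h s hs k hk => h _ ⟨s, hs, k, hk, rfl⟩, fun h _ ⟨s, hs, k, hk, e⟩ => e ▸ h s hs k hk⟩

theorem annSocleMul_anti {K L : Ideal A} (h : K ≤ L) : annSocleMul L ≤ annSocleMul K :=
  fun _ ha => mem_annSocleMul.2 fun s hs k hk => mem_annSocleMul.1 ha s hs k (h hk)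

instance (K : Ideal A) : (annSocleMul K).IsTwoSided := ⟨fun {a} b ha => mem_annSocleMul.2
  fun s hs k hk => by
    have := mem_annSocleMul.1 ha (b * s) (mul_mem_radAnn_left hs b) k hk
    simpa only [mul_assoc] using this⟩

theorem jacobson_le_annSocleMul (K : Ideal A) : Ring.jacobson A ≤ annSocleMul K :=
  fun a ha => mem_annSocleMul.2 fun s hs k _ => by rw [← mul_assoc, hs a ha, zero_mul]

/-- A two-sided ideal `K` containing the radical is determined by `annSocleMul K`: the sub-bimodule
`S * K` of the socle `S` is a sum of isotypic components of `S`, because homomorphisms between left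
ideals are right multiplications, and so it is determined by its annihilator; and `S * K` determines
`K` because `S` is a faithful right module over the semisimple ring `A ⧸ J`. -/
theorem ACCLeftAnn.mem_of_annSocleMul (hacc : ACCLeftAnn A) (hA : Module.Baer A A) (K : Ideal A)
    [K.IsTwoSided] (hJ : Ring.jacobson A ≤ K) {a : A}
    (h : ∀ l ∈ annSocleMul K, ∀ s ∈ radAnn A, l * (s * a) = 0) : a ∈ K := by
  obtain ⟨f, hf, hKf⟩ := hacc.exists_sub_one_mem hA K
  by_contra haK
  have haf : a * f ∉ Ring.jacobson A := fun haf => haK <| by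
    have := K.sub_mem (hJ haf) (K.mul_mem_left a hf)
    rwa [mul_sub, mul_one, sub_sub_cancel] at this
  obtain ⟨s, hs, hsaf⟩ : ∃ s ∈ radAnn A, s * (a * f) ≠ 0 := by
    by_contra! hall
    exact haf (hacc.mem_jacobson_of_radAnn_mul hA hall)
  obtain ⟨c, hm⟩ := hacc.exists_isMaximal_leftAnn hA (mul_mem_radAnn_right hs (a * f)) hsaf
  set t := c * (s * (a * f)) with ht
  have ht0 : t ≠ 0 := ne_zero_of_leftAnn_ne_top.1 hm.ne_top
  have hcs : c * s ∈ radAnn A := mul_mem_radAnn_left hs c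
  obtain ⟨g, hg, hmg⟩ := hacc.exists_sub_one_mem hA (leftAnn {t})
  have hgt : g * t = t := by
    rwa [mem_leftAnn_singleton, sub_mul, one_mul, sub_eq_zero] at hg
  have hgK : g ∉ annSocleMul K := fun hgK => ht0 <| by
    rw [← hgt, ht]
    calc g * (c * (s * (a * f))) = g * (c * s * a) * f := by noncomm_ring
      _ = 0 := by rw [h g hgK _ hcs, zero_mul]
  rw [mem_annSocleMul] at hgK
  push Not at hgK
  obtain ⟨s₀, hs₀, k, hk, hy⟩ := hgK
  -- `A * t` is a simple left ideal, so it is isomorphic to `A * (g * (s₀ * k)) ⊆ S * K`.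
  obtain ⟨d, hd⟩ := hA.exists_eq_mul_of_isMaximal hm (fun u hu => by
    rw [mem_leftAnn_singleton]
    calc u * (g * (s₀ * k)) = u * g * s₀ * k := by noncomm_ring
      _ = 0 := by rw [hs₀ _ (hmg u hu), zero_mul]) hy
  have htf : t * f = t := by
    rw [← sub_eq_zero]
    calc t * f - t = c * s * a * ((f - 1) * f) := by rw [ht]; noncomm_ring
      _ = 0 := hacc.radAnn_mul_jacobson hA (mul_mem_radAnn_right hcs a) (hKf _ hf)
  refine ht0 ?_
  calc t = g * s₀ * (k * d * f) := by rw [← htf, hd]; noncomm_ring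
    _ = 0 := hacc.radAnn_mul_jacobson hA (mul_mem_radAnn_left hs₀ g)
      (hKf _ (K.mul_mem_right d hk))

theorem ACCLeftAnn.annSocleMul_lt (hacc : ACCLeftAnn A) (hA : Module.Baer A A) {K L : Ideal A}
    [K.IsTwoSided] (hJ : Ring.jacobson A ≤ K) (h : K < L) : annSocleMul L < annSocleMul K := by
  refine lt_of_le_not_ge (annSocleMul_anti h.le) fun hle => h.not_ge fun a ha => ?_
  exact hacc.mem_of_annSocleMul hA K hJ fun l hl s hs => mem_annSocleMul.1 (hle hl) s hs a ha

/-- The order-reversing operation `annSocleMul` squares to a strictly increasing operation on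
two-sided ideals containing the radical; by the chain condition its value at the smallest of
them, the radical `J`, is `J` again. That value is the annihilator of the socle. -/
theorem ACCLeftAnn.leftAnn_radAnn (hacc : ACCLeftAnn A) (hA : Module.Baer A A) :
    leftAnn (radAnn A) = Ring.jacobson A := by
  have hJle : Ring.jacobson A ≤ leftAnn (radAnn A) := fun a ha s hs => hs a ha
  refine (eq_of_le_of_not_lt hJle fun hlt => ?_).symm
  have htop : annSocleMul (⊤ : Ideal A) = leftAnn (radAnn A) := le_antisymm
    (fun a ha s hs => by simpa using mem_annSocleMul.1 ha s hs 1 trivial)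
    (fun a ha => mem_annSocleMul.2 fun s hs k _ => by rw [← mul_assoc, ha s hs, zero_mul])
  have hbot : annSocleMul (Ring.jacobson A) = ⊤ := eq_top_iff.2 fun a _ => mem_annSocleMul.2
    fun s hs k hk => by rw [hacc.radAnn_mul_jacobson hA hs hk, mul_zero]
  have step : ∀ K : Ideal A, K.IsTwoSided → Ring.jacobson A ≤ K →
      K < annSocleMul (annSocleMul K) →
      annSocleMul (annSocleMul K) < annSocleMul (annSocleMul (annSocleMul (annSocleMul K))) :=
    fun K _ hJ hK => hacc.annSocleMul_lt hA (jacobson_le_annSocleMul _)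
      (hacc.annSocleMul_lt hA hJ hK)
  have hJ := step _ inferInstance le_rfl (by rwa [hbot, htop])
  rw [hbot] at hJ
  obtain ⟨X, ⟨K, hX, hK⟩, hmin⟩ := hacc.has_min
    {X | ∃ K : Ideal A, leftAnn X = annSocleMul K ∧
      annSocleMul K < annSocleMul (annSocleMul (annSocleMul K))}
    ⟨radAnn A, ⊤, htop.symm, hJ⟩
  refine hmin _ ⟨annSocleMul (annSocleMul K), rfl,
    step _ inferInstance (jacobson_le_annSocleMul K) hK⟩ ?_
  rw [hX]
  exact hK

/-- Every simple left module embeds into the left module `A`. -/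
theorem ACCLeftAnn.exists_ne_zero_of_isMaximal (hacc : ACCLeftAnn A) (hA : Module.Baer A A)
    {m : Ideal A} (hm : m.IsMaximal) : ∃ y : A, y ≠ 0 ∧ ∀ a ∈ m, a * y = 0 := by
  obtain ⟨b, hb, hmb⟩ := hacc.exists_sub_one_mem hA m
  have hbJ : b ∉ leftAnn (radAnn A) := fun h => hm.ne_top <| by
    rw [hacc.leftAnn_radAnn hA] at h
    have := m.sub_mem (jacobson_le_of_isMaximal hm h) hb
    rwa [sub_sub_cancel, ← Ideal.eq_top_iff_one] at this
  rw [mem_leftAnn] at hbJ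
  push Not at hbJ
  obtain ⟨s, hs, hbs⟩ := hbJ
  exact ⟨b * s, hbs, fun a ha => by rw [← mul_assoc]; exact hs _ (hmb a ha)⟩

/-- The left module `A` is a cogenerator. -/
theorem ACCLeftAnn.exists_linearMap_apply_ne_zero (hacc : ACCLeftAnn A) (hA : Module.Baer A A)
    {M : Type*} [AddCommGroup M] [Module A M] {v : M} (hv : v ≠ 0) : ∃ φ : M →ₗ[A] A, φ v ≠ 0 := by
  have hker : LinearMap.ker (LinearMap.toSpanSingleton A M v) ≠ ⊤ := fun h => hv <| by
    have : (1 : A) ∈ LinearMap.ker (LinearMap.toSpanSingleton A M v) := h ▸ trivial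
    simpa using this
  obtain ⟨m, hm, hle⟩ := Ideal.exists_le_maximal _ hker
  obtain ⟨y, hy, hmy⟩ := hacc.exists_ne_zero_of_isMaximal hA hm
  obtain ⟨φ, hφ⟩ := hA.exists_factor (LinearMap.toSpanSingleton A M v)
    (LinearMap.toSpanSingleton A A y) fun a ha => hmy a (hle ha)
  refine ⟨φ, ?_⟩
  have := hφ 1
  rw [LinearMap.toSpanSingleton_apply, one_smul, LinearMap.toSpanSingleton_apply, one_smul] at this
  rwa [this]

/-- Every left ideal is the left annihilator of its right annihilator, so the chain condition holds
for all left ideals. -/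
theorem ACCLeftAnn.isNoetherianRing (hacc : ACCLeftAnn A) (hA : Module.Baer A A) :
    IsNoetherianRing A := by
  let r : Ideal A → Set A := fun I => {x | ∀ a ∈ I, a * x = 0}
  have hr : ∀ I, leftAnn (r I) = I := fun I => by
    refine le_antisymm (fun a ha => ?_) fun a ha x hx => hx a ha
    by_contra haI
    obtain ⟨φ, hφ⟩ := hacc.exists_linearMap_apply_ne_zero hA
      (v := (Submodule.Quotient.mk a : A ⧸ I))
      (fun h => haI ((Submodule.Quotient.mk_eq_zero I).1 h))
    have hφm : ∀ c : A, φ (Submodule.Quotient.mk c) = c * φ (Submodule.Quotient.mk 1) := fun c => by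
      rw [← smul_eq_mul, ← map_smul, ← Submodule.Quotient.mk_smul, smul_eq_mul, mul_one]
    refine hφ ?_
    rw [hφm]
    refine ha _ fun c hc => ?_
    rw [← hφm, (Submodule.Quotient.mk_eq_zero I).2 hc, map_zero]
  rw [isNoetherianRing_iff, isNoetherian_iff]
  refine Subrelation.wf (fun {I K} h => ?_) (InvImage.wf r hacc)
  change leftAnn (r K) < leftAnn (r I)
  rwa [hr, hr]

end InjectiveRing

/-! ### Left Noetherian left self-injective rings -/

section SelfInjectiveNoetherian

variable {A : Type u} [Ring A]

theorem accLeftAnn_of_isNoetherianRing [IsNoetherianRing A] : ACCLeftAnn A :=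
  InvImage.wf leftAnn (wellFounded_gt (α := Ideal A))

theorem Module.Baer.isArtinianRing [IsNoetherianRing A] (hA : Module.Baer A A) :
    IsArtinianRing A := by
  have := (accLeftAnn_of_isNoetherianRing (A := A)).isSemiprimaryRing hA
  exact IsSemiprimaryRing.isNoetherian_iff_isArtinian.1 ‹_›

/-- Being left Noetherian and left self-injective passes to the opposite ring: if `S` is
anti-isomorphic to `R` via `φ`, then finitely generated left ideals of `S` correspond to right
ideals of `R` which are right annihilators, and `R` is a cogenerator. -/
theorem isNoetherianRing_and_baer_of_antiEquiv {R S : Type u} [Ring R] [Ring S]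
    [IsNoetherianRing R] (hR : Module.Baer R R) (φ : S ≃+ R)
    (hφ : ∀ s t, φ (s * t) = φ t * φ s) : IsNoetherianRing S ∧ Module.Baer S S := by
  have hacc := accLeftAnn_of_isNoetherianRing (A := R)
  have := hR.isArtinianRing
  have hfg : ∀ L : Ideal S, L.FG := fun L => by
    classical
    obtain ⟨_, ⟨F, hFL, rfl⟩, hmin⟩ := (wellFounded_lt (α := Ideal R)).has_min
      {I | ∃ F : Finset S, (F : Set S) ⊆ L ∧ I = leftAnn (φ '' F)} ⟨_, ∅, by simp, rfl⟩
    refine ⟨F, le_antisymm (Submodule.span_le.2 hFL) fun x hx => ?_⟩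
    obtain ⟨c, hc⟩ := hR.exists_eq_sum_mul (fun i : F => φ i) (φ x) fun a ha => by
      by_contra hax
      refine hmin _ ⟨insert x F, ?_, rfl⟩ (lt_of_le_of_ne ?_ fun h => ?_)
      · rw [Finset.coe_insert]
        exact Set.insert_subset hx hFL
      · exact fun b hb y hy => hb y (Set.image_mono (by simp) hy)
      · have : a ∈ leftAnn (φ '' (F : Set S)) := by
          rintro _ ⟨y, hy, rfl⟩
          exact ha ⟨y, hy⟩
        rw [← h] at this
        exact hax (this _ ⟨x, by simp, rfl⟩)
    have hx' : x = ∑ i : F, φ.symm (c i) * i := by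
      apply φ.injective
      rw [hc, map_sum]
      simp [hφ]
    rw [hx']
    exact Submodule.sum_mem _ fun i _ => Ideal.mul_mem_left _ _ (Submodule.subset_span i.2)
  refine ⟨(isNoetherianRing_iff_ideal_fg S).2 hfg, fun L g => ?_⟩
  obtain ⟨F, rfl⟩ := hfg L
  have hmem : ∀ i : F, (i : S) ∈ Submodule.span S (F : Set S) := fun i => Submodule.subset_span i.2
  let v : F → R := fun i => φ i
  let w : F → R := fun i => φ (g ⟨i, hmem i⟩)
  -- Otherwise a linear form on `Rⁿ` vanishing at `v` but not at `w` gives coefficients of a linear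
  -- relation between the generators that `g` does not preserve.
  have hw : w ∈ Submodule.span R {v} := by
    classical
    by_contra hw
    obtain ⟨ψ, hψ⟩ := hacc.exists_linearMap_apply_ne_zero hR
      (v := (Submodule.Quotient.mk w : (F → R) ⧸ Submodule.span R {v}))
      (fun h => hw ((Submodule.Quotient.mk_eq_zero _).1 h))
    let θ := ψ ∘ₗ Submodule.mkQ (Submodule.span R {v})
    have hθ : ∀ u : F → R, θ u = ∑ i, u i * θ (fun j => if i = j then 1 else 0) := fun u =>
      LinearMap.pi_apply_eq_sum_univ θ u
    set z : F → S := fun i => φ.symm (θ (fun j => if i = j then 1 else 0)) with hz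
    have hsum : ∀ u : F → S, θ (fun i => φ (u i)) = φ (∑ i, z i * u i) := fun u => by
      rw [hθ, map_sum]
      simp [hφ, hz]
    have h0 : ∑ i, z i * (i : S) = 0 := by
      apply φ.injective
      rw [← hsum, map_zero]
      have : (Submodule.Quotient.mk v : (F → R) ⧸ Submodule.span R {v}) = 0 :=
        (Submodule.Quotient.mk_eq_zero _).2 (Submodule.mem_span_singleton_self v)
      exact (congrArg ψ this).trans (map_zero ψ)
    refine hψ ((hsum fun i => g ⟨i, hmem i⟩).trans ?_)
    have h1 : ∑ i, z i * g ⟨i, hmem i⟩ =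
        g (∑ i, z i • (⟨i, hmem i⟩ : Submodule.span S (F : Set S))) := by
      rw [map_sum]
      simp only [map_smul, smul_eq_mul]
    have h2 : ∑ i, z i • (⟨i, hmem i⟩ : Submodule.span S (F : Set S)) = 0 := by
      ext
      simpa using h0
    rw [h1, h2, map_zero, map_zero]
  obtain ⟨c, hc⟩ := Submodule.mem_span_singleton.1 hw
  refine ⟨LinearMap.toSpanSingleton S S (φ.symm c), fun x hx => ?_⟩
  rw [LinearMap.toSpanSingleton_apply, smul_eq_mul]
  induction hx using Submodule.span_induction with
  | mem x hx =>
    apply φ.injective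
    have := congrFun hc ⟨x, hx⟩
    simpa [hφ, v, w] using this
  | zero => exact (zero_mul _).trans (map_zero g).symm
  | add x y hx hy ihx ihy =>
    rw [add_mul, ihx, ihy, ← map_add]
    rfl
  | smul a x hx ih =>
    rw [smul_mul_assoc, ih, ← map_smul]
    rfl

theorem Module.Baer.finsupp [IsNoetherianRing A] (hA : Module.Baer A A) (ι : Type*) :
    Module.Baer A (ι →₀ A) := fun I g => by
  classical
  obtain ⟨T, hT⟩ : (LinearMap.range g).FG := by
    rw [LinearMap.range_eq_map]
    exact (IsNoetherian.noetherian ⊤).map g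
  let s : Finset ι := T.biUnion Finsupp.support
  have hs : ∀ x j, j ∉ s → g x j = 0 := fun x j hj => by
    have hle : LinearMap.range g ≤ LinearMap.ker (Finsupp.lapply j : (ι →₀ A) →ₗ[A] A) := by
      rw [← hT, Submodule.span_le]
      intro t ht
      by_contra h
      exact hj (Finset.mem_biUnion.2 ⟨t, ht, Finsupp.mem_support_iff.2 h⟩)
    exact hle ⟨x, rfl⟩
  choose h hh using fun j => hA I (Finsupp.lapply j ∘ₗ g)
  refine ⟨∑ j ∈ s, Finsupp.lsingle j ∘ₗ h j, fun x hx => Finsupp.ext fun j => ?_⟩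
  simp only [LinearMap.sum_apply, LinearMap.comp_apply, hh _ x hx, Finsupp.lapply_apply,
    Finsupp.lsingle_apply, Finsupp.finsetSum_apply, Finsupp.single_apply]
  rw [Finset.sum_ite_eq' s j]
  split_ifs with hj
  · rfl
  · exact (hs _ _ hj).symm

theorem exists_isSimpleModule_le [IsArtinianRing A] {M : Type*} [AddCommGroup M] [Module A M]
    {N : Submodule A M} (hN : N ≠ ⊥) : ∃ T ≤ N, IsSimpleModule A T := by
  obtain ⟨x, hx, hx0⟩ := (Submodule.ne_bot_iff N).1 hN
  let P := Submodule.span A {x}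
  have : IsArtinian A P := inferInstance
  have : IsAtomic (Submodule A P) := isAtomic_of_orderBot_wellFounded_lt wellFounded_lt
  have : Nontrivial P := ⟨⟨x, Submodule.mem_span_singleton_self x⟩, 0,
    fun h => hx0 (congrArg Subtype.val h)⟩
  obtain ⟨a, ha⟩ := IsAtomic.exists_atom (Submodule A P)
  have := isSimpleModule_iff_isAtom.2 ha
  refine ⟨a.map P.subtype, (Submodule.map_subtype_le P a).trans ?_,
    IsSimpleModule.congr (a.equivMapOfInjective _ P.subtype_injective).symm⟩
  exact (Submodule.span_singleton_le_iff_mem x N).2 hx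

/-- The socle of `M` embeds into a free module because every simple module embeds into `A`; the
embedding extends to `M` because free modules are injective, and it stays injective because the
socle is essential. -/
theorem Module.Baer.exists_injective_finsupp [IsNoetherianRing A] (hA : Module.Baer A A)
    (M : Type u) [AddCommGroup M] [Module A M] :
    ∃ (ι : Type u) (f : M →ₗ[A] (ι →₀ A)), Function.Injective f := by
  classical
  have hacc := accLeftAnn_of_isNoetherianRing (A := A)
  have := hA.isArtinianRing
  let N : Submodule A M := ⨆ T ∈ {T : Submodule A M | IsSimpleModule A T}, T
  have hTN : ∀ T : Submodule A M, IsSimpleModule A T → T ≤ N := fun T hT =>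
    le_biSup (fun T : Submodule A M => T) hT
  have : IsSemisimpleModule A N :=
    isSemisimpleModule_biSup_of_isSemisimpleModule_submodule (p := fun T : Submodule A M => T)
      fun T (hT : IsSimpleModule A T) => inferInstance
  obtain ⟨s, e, -, hs⟩ := IsSemisimpleModule.exists_linearEquiv_dfinsupp A N
  have hφ : ∀ m : s, ∃ φ : m.1 →ₗ[A] A, Function.Injective φ := fun m => by
    have := hs m
    have := IsSimpleModule.nontrivial A m.1
    obtain ⟨v, hv⟩ := exists_ne (0 : m.1)
    obtain ⟨φ, hφ⟩ := hacc.exists_linearMap_apply_ne_zero hA hv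
    exact ⟨φ, (LinearMap.injective_or_eq_zero φ).resolve_right fun h => hφ (by rw [h]; rfl)⟩
  choose φ hφ using hφ
  let f₀ : N →ₗ[A] (s →₀ A) := (finsuppLequivDFinsupp A).symm.toLinearMap ∘ₗ
    DFinsupp.mapRange.linearMap φ ∘ₗ e.toLinearMap
  have hf₀ : Function.Injective f₀ := (finsuppLequivDFinsupp A).symm.injective.comp
    (((DFinsupp.mapRange_injective (fun i => φ i) fun i => map_zero _).2 hφ).comp e.injective)
  obtain ⟨f, hf⟩ := (hA.finsupp s).extension_property N.subtype N.subtype_injective f₀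
  refine ⟨s, f, LinearMap.ker_eq_bot.1 ?_⟩
  by_contra hker
  obtain ⟨T, hT, hTs⟩ := exists_isSimpleModule_le hker
  have := IsSimpleModule.nontrivial A T
  obtain ⟨t, ht⟩ := exists_ne (0 : T)
  have h1 : f₀ ⟨t, hTN T hTs t.2⟩ = 0 := by
    rw [← hf]
    exact hT t.2
  have h2 := (map_eq_zero_iff f₀ hf₀).1 h1
  exact ht (Subtype.ext (congrArg (fun y : N => (y : M)) h2))

end SelfInjectiveNoetherian

/-! ### Flat modules -/

section BalancedTensor

variable {A : Type u} [Ring A]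
variable {N N' : Type u} [AddCommGroup N] [Module Aᵐᵒᵖ N] [AddCommGroup N'] [Module Aᵐᵒᵖ N']
variable {M M' : Type u} [AddCommGroup M] [Module A M] [AddCommGroup M'] [Module A M']

namespace BalancedTensor

variable (A) in
/-- The class of `x ⊗ m` in the balanced tensor product. -/
def tmul (x : N) (m : M) : BalancedTensor A N M := QuotientAddGroup.mk (x ⊗ₜ[ℤ] m)

/-- The additive map out of the balanced tensor product given by a balanced biadditive map. -/
def lift {G : Type*} [AddCommGroup G] (f : N →+ M →+ G)
    (hf : ∀ x (a : A) m, f (MulOpposite.op a • x) m = f x (a • m)) : BalancedTensor A N M →+ G :=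
  QuotientAddGroup.lift _ (TensorProduct.liftAddHom f fun r m n => by simp) (by
    refine (AddSubgroup.closure_le _).2 ?_
    rintro _ ⟨x, a, m, rfl⟩
    simp [hf])

theorem lift_tmul {G : Type*} [AddCommGroup G] (f : N →+ M →+ G)
    (hf : ∀ x (a : A) m, f (MulOpposite.op a • x) m = f x (a • m)) (x : N) (m : M) :
    lift f hf (tmul A x m) = f x m := rfl

theorem map_tmul (f : N →ₗ[Aᵐᵒᵖ] N') (x : N) (m : M) :
    map A f M (tmul A x m) = tmul A (f x) m := rfl

variable (A N M) in
/-- The universal biadditive map to the balanced tensor product. -/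
def tmulHom : N →+ M →+ BalancedTensor A N M :=
  AddMonoidHom.mk' (fun x => AddMonoidHom.mk' (tmul A x) fun m m' => by
      rw [tmul, TensorProduct.tmul_add]; rfl) fun x x' => by
    ext m
    change tmul A (x + x') m = tmul A x m + tmul A x' m
    rw [tmul, TensorProduct.add_tmul]
    rfl

theorem tmulHom_apply (x : N) (m : M) : tmulHom A N M x m = tmul A x m := rfl

theorem smul_tmul (x : N) (a : A) (m : M) :
    tmul A (MulOpposite.op a • x) m = tmul A x (a • m) := by
  rw [tmul, tmul, QuotientAddGroup.eq_iff_sub_mem]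
  exact AddSubgroup.subset_closure ⟨x, a, m, rfl⟩

theorem induction_on {p : BalancedTensor A N M → Prop} (t : BalancedTensor A N M) (zero : p 0)
    (tmul : ∀ x m, p (tmul A x m)) (add : ∀ s t, p s → p t → p (s + t)) : p t := by
  induction t using QuotientAddGroup.induction_on with
  | H t =>
    induction t using TensorProduct.induction_on with
    | zero => exact zero
    | tmul x m => exact tmul x m
    | add s t hs ht => exact add _ _ hs ht

variable (N) in
/-- The map `N ⊗ M → N ⊗ M'` induced by a homomorphism `M → M'`. -/
def mapRight (g : M →ₗ[A] M') : BalancedTensor A N M →+ BalancedTensor A N M' :=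
  lift ((AddMonoidHom.compHom.flip g.toAddMonoidHom).comp (tmulHom A N M')) fun x a m => by
    change tmul A (MulOpposite.op a • x) (g m) = tmul A x (g (a • m))
    rw [smul_tmul, map_smul]

theorem map_mapRight (f : N →ₗ[Aᵐᵒᵖ] N') (g : M →ₗ[A] M') (t : BalancedTensor A N M) :
    map A f M' (mapRight N g t) = mapRight N' g (map A f M t) := by
  induction t using induction_on with
  | zero => simp only [map_zero]
  | tmul x m => rfl
  | add s t hs ht => simp only [map_add, hs, ht]

theorem mapRight_of_comp_eq_id (s : M →ₗ[A] M') (p : M' →ₗ[A] M) (h : p ∘ₗ s = LinearMap.id)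
    (t : BalancedTensor A N M) : mapRight N p (mapRight N s t) = t := by
  induction t using induction_on with
  | zero => simp only [map_zero]
  | tmul x m => exact congrArg (tmul A x) (LinearMap.congr_fun h m)
  | add s t hs ht => simp only [map_add, hs, ht]

variable (A N) in
/-- The coordinates of an element of the tensor product of `N` with a free module. -/
noncomputable def coordinates (ι : Type u) : BalancedTensor A N (ι →₀ A) →+ (ι →₀ N) :=
  lift (AddMonoidHom.mk' (fun x => Finsupp.mapRange.addMonoidHom
      (AddMonoidHom.mk' (fun a : A => MulOpposite.op a • x) fun a b => by
        rw [MulOpposite.op_add, add_smul])) fun x y => by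
    ext i a : 2
    simp [Finsupp.single_add]) fun x a m => by
    ext i
    simp [mul_smul]

theorem coordinates_tmul {ι : Type u} (x : N) (m : ι →₀ A) (i : ι) :
    coordinates A N ι (tmul A x m) i = MulOpposite.op (m i) • x := by
  simp [coordinates, lift_tmul]

theorem coordinates_injective (ι : Type u) : Function.Injective (coordinates A N ι) := by
  let σ : (ι →₀ N) →+ BalancedTensor A N (ι →₀ A) :=
    Finsupp.liftAddHom fun i => (tmulHom A N (ι →₀ A)).flip (Finsupp.single i 1)
  refine Function.LeftInverse.injective (g := σ) fun t => ?_
  induction t using induction_on with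
  | zero => simp only [map_zero]
  | add s t hs ht => simp only [map_add, hs, ht]
  | tmul x m =>
    rw [← tmulHom_apply]
    induction m using Finsupp.induction_linear with
    | zero => simp only [map_zero]
    | add m m' hm hm' => simp only [map_add, hm, hm']
    | single i a =>
      have : coordinates A N ι (tmulHom A N _ x (Finsupp.single i a)) =
          Finsupp.single i (MulOpposite.op a • x) := by
        classical
        ext j
        rw [tmulHom_apply, coordinates_tmul, Finsupp.single_apply, Finsupp.single_apply]
        split_ifs <;> simp
      rw [this]
      simp only [σ, Finsupp.liftAddHom_apply_single, AddMonoidHom.flip_apply, tmulHom_apply,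
        smul_tmul, Finsupp.smul_single, smul_eq_mul, mul_one]

theorem coordinates_map {ι : Type u} (f : N →ₗ[Aᵐᵒᵖ] N') (t : BalancedTensor A N (ι →₀ A)) (i : ι) :
    coordinates A N' ι (map A f _ t) i = f (coordinates A N ι t i) := by
  induction t using induction_on with
  | zero => simp only [map_zero, Finsupp.zero_apply]
  | tmul x m => rw [map_tmul, coordinates_tmul, coordinates_tmul, map_smul]
  | add s t hs ht => simp only [map_add, Finsupp.add_apply, hs, ht]

/-- Right exactness of the tensor product: the kernel of `N ⊗ M → N' ⊗ M` is generated by the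
elements `y ⊗ m` with `y` in the kernel of `N → N'`. -/
theorem mem_closure_of_map_eq_zero {π : N →ₗ[Aᵐᵒᵖ] N'} (hπ : Function.Surjective π)
    {t : BalancedTensor A N M} (ht : map A π M t = 0) :
    t ∈ AddSubgroup.closure {t | ∃ y m, π y = 0 ∧ t = tmul A y m} := by
  set D : AddSubgroup (BalancedTensor A N M) :=
    AddSubgroup.closure {t | ∃ y m, π y = 0 ∧ t = tmul A y m} with hD
  let g : N →+ M →+ BalancedTensor A N M ⧸ D :=
    (AddMonoidHom.compHom (QuotientAddGroup.mk' D)).comp (tmulHom A N M)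
  have hg : π.toAddMonoidHom.ker ≤ g.ker := fun y hy => by
    ext m
    exact (QuotientAddGroup.eq_zero_iff _).2 (AddSubgroup.subset_closure ⟨y, m, hy, rfl⟩)
  let g' : N' →+ M →+ BalancedTensor A N M ⧸ D :=
    AddMonoidHom.liftOfSurjective π.toAddMonoidHom hπ ⟨g, hg⟩
  have hg' : ∀ y, g' (π y) = g y := fun y =>
    AddMonoidHom.liftOfRightInverse_comp_apply π.toAddMonoidHom _ (Function.rightInverse_surjInv hπ)
      ⟨g, hg⟩ y
  let F : BalancedTensor A N' M →+ BalancedTensor A N M ⧸ D := lift g' fun x a m => by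
    obtain ⟨y, rfl⟩ := hπ x
    rw [← map_smul, hg', hg']
    exact congrArg (QuotientAddGroup.mk' D) (smul_tmul y a m)
  have hF : ∀ t, F (map A π M t) = QuotientAddGroup.mk' D t := fun t => by
    induction t using induction_on with
    | zero => simp only [map_zero]
    | tmul x m =>
      rw [map_tmul, lift_tmul, hg']
      rfl
    | add s t hs ht => simp only [map_add, hs, ht]
  exact (QuotientAddGroup.eq_zero_iff t).1 (by
    have := hF t
    rw [ht, map_zero] at this
    exact this.symm)

end BalancedTensor

theorem isFlatModule_of_projective {P : ModuleCat.{u} A} (hP : Projective P) :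
    IsFlatModule A P := by
  intro N N' _ _ _ _ f hf t t' h
  obtain ⟨s, hs⟩ := Module.projective_def'.1 ((IsProjective.iff_projective (R := A) P).2 hP)
  rw [← BalancedTensor.mapRight_of_comp_eq_id s _ hs t,
    ← BalancedTensor.mapRight_of_comp_eq_id s _ hs t']
  congr 1
  apply BalancedTensor.coordinates_injective
  ext i
  apply hf
  rw [← BalancedTensor.coordinates_map, ← BalancedTensor.coordinates_map,
    BalancedTensor.map_mapRight, BalancedTensor.map_mapRight, h]

open BalancedTensor in
/-- A homomorphism `g` from a left ideal `I` to a flat module factors, because `I` is finitely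
presented, through a free module of finite rank, and the components `I → A` of the first factor
extend to `A`. The proof encodes `I` by generators `F` and relations `R`: the matrix of the
relations is a homomorphism `ρ` of free right modules, and flatness shows that the element `t`
of `Aⁿ ⊗ C` given by the values of `g` at the generators comes from `ker ρ ⊗ C`. -/
theorem IsFlatModule.baer [IsNoetherianRing A] (hA : Module.Baer A A) {C : ModuleCat.{u} A}
    (hC : IsFlatModule A C) : Module.Baer A C := fun I g => by
  classical
  obtain ⟨F, rfl⟩ : I.FG := IsNoetherian.noetherian I
  have hmem : ∀ i : F, (i : A) ∈ Submodule.span A (F : Set A) := fun i => Submodule.subset_span i.2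
  let π := Fintype.linearCombination A (fun i : F => (i : A))
  obtain ⟨R, hR⟩ : (LinearMap.ker π).FG := IsNoetherian.noetherian _
  let x : F → C := fun i => g ⟨i, hmem i⟩
  have hx : ∀ r ∈ R, ∑ i, r i • x i = 0 := fun r hr => by
    have hr' : π r = 0 := by
      have : r ∈ LinearMap.ker π := hR ▸ Submodule.subset_span hr
      exact this
    have h2 : ∑ i, r i • (⟨i, hmem i⟩ : Submodule.span A (F : Set A)) = 0 := by
      ext
      simpa [π, Fintype.linearCombination_apply] using hr'
    have := congrArg g h2
    rw [map_sum, map_zero] at this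
    simpa only [map_smul] using this
  let ρ : (F → A) →ₗ[Aᵐᵒᵖ] (R → A) :=
    { toFun := fun y r => ∑ i, r.1 i * y i
      map_add' := fun y y' => by ext r; simp [mul_add, Finset.sum_add_distrib]
      map_smul' := fun a y => by ext r; simp [Finset.sum_mul, mul_assoc] }
  let t : BalancedTensor A (F → A) C := ∑ i, tmul A (Pi.single i 1) (x i)
  have ht : map A ρ C t = 0 := by
    have h1 : ∀ i, ρ (Pi.single i 1) = ∑ r, MulOpposite.op (r.1 i) • (Pi.single r 1 : R → A) :=
      fun i => by
        ext r
        simp [ρ, Pi.single_apply]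
    simp only [t, map_sum, map_tmul, h1]
    simp only [← tmulHom_apply, map_sum, AddMonoidHom.finsetSum_apply]
    simp only [tmulHom_apply, smul_tmul]
    rw [Finset.sum_comm]
    refine Finset.sum_eq_zero fun r _ => ?_
    simp only [← tmulHom_apply, ← map_sum, hx r.1 r.2, map_zero]
  have ht' : map A ρ.rangeRestrict C t = 0 := by
    apply hC _ _ (LinearMap.range ρ).subtype (Submodule.subtype_injective _)
    rw [map_zero, ← ht]
    simp only [t, map_sum, map_tmul]
    rfl
  let γ : BalancedTensor A (F → A) C →+ (F → C) :=
    lift (AddMonoidHom.mk' (fun y => AddMonoidHom.mk' (fun c i => y i • c) fun c c' => by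
        ext i; simp) fun y y' => by ext c i; simp [add_smul]) fun y a c => by
      ext i; simp [mul_smul]
  have hγt : γ t = x := by
    ext j
    simp only [t, map_sum, γ, lift_tmul]
    simp [Pi.single_apply]
  -- The families which are the values at the generators of a linear map defined on `A`.
  let E : AddSubgroup (F → C) :=
    (LinearMap.range (LinearMap.pi fun i : F =>
      LinearMap.applyₗ' ℤ (i : A) : (A →ₗ[A] C) →ₗ[ℤ] (F → C))).toAddSubgroup
  have hE : ∀ z : F → C, z ∈ E ↔ ∃ h : A →ₗ[A] C, ∀ i : F, h i = z i := fun z => by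
    refine exists_congr fun h => funext_iff
  have hcl : AddSubgroup.closure {t | ∃ y m, ρ.rangeRestrict y = 0 ∧ t = tmul A y m} ≤
      E.comap γ := by
    refine (AddSubgroup.closure_le _).2 ?_
    rintro _ ⟨y, c, hy, rfl⟩
    have hy' : ∀ r ∈ R, ∑ i, r i * y i = 0 := fun r hr =>
      congrFun (congrArg Subtype.val hy) ⟨r, hr⟩
    obtain ⟨h, hh⟩ := hA.exists_factor π (Fintype.linearCombination A y) (by
      rw [← hR, Submodule.span_le]
      intro r hr
      exact hy' r hr)
    have hh' : ∀ i : F, h i = y i := fun i => by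
      have := hh (Pi.single i 1)
      simpa [π] using this
    refine (hE _).2 ⟨LinearMap.toSpanSingleton A C c ∘ₗ h, fun i => ?_⟩
    simp only [LinearMap.comp_apply, hh', LinearMap.toSpanSingleton_apply]
    rfl
  obtain ⟨h, hh⟩ := (hE _).1 (hcl (mem_closure_of_map_eq_zero ρ.surjective_rangeRestrict ht'))
  rw [hγt] at hh
  refine ⟨h, fun a ha => ?_⟩
  induction ha using Submodule.span_induction with
  | mem a ha => exact hh ⟨a, ha⟩
  | zero => exact (map_zero h).trans (map_zero g).symm
  | add a b ha hb iha ihb =>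
    rw [map_add, iha, ihb, ← map_add]
    rfl
  | smul c a ha ih =>
    rw [map_smul, ih, ← map_smul]
    rfl

end BalancedTensor

/-! ### Quasi-Frobenius rings -/

section QuasiFrobenius

variable {A : Type u} [Ring A]

theorem Module.Baer.injective_moduleCat {M : ModuleCat.{u} A} (hM : Module.Baer A M) :
    CategoryTheory.Injective M :=
  have := hM.injective
  Module.injective_object_of_injective_module A M

theorem baer_of_injective_moduleCat {M : ModuleCat.{u} A} (hM : CategoryTheory.Injective M) :
    Module.Baer A M :=
  Module.Baer.of_injective (Module.injective_module_of_injective_object A M)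

theorem IsQuasiFrobenius.baer (h : IsQuasiFrobenius A) (P : Type u) [AddCommGroup P] [Module A P]
    [Module.Projective A P] : Module.Baer A P :=
  baer_of_injective_moduleCat (M := ModuleCat.of A P)
    (h _ ((IsProjective.iff_projective P).1 inferInstance))

theorem Module.Baer.of_projective [IsNoetherianRing A] (hA : Module.Baer A A) (P : Type u)
    [AddCommGroup P] [Module A P] [Module.Projective A P] : Module.Baer A P := fun I g => by
  obtain ⟨s, hs⟩ := Module.projective_def'.1 (inferInstance : Module.Projective A P)
  obtain ⟨h, hh⟩ := hA.finsupp P I (s ∘ₗ g)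
  refine ⟨Finsupp.linearCombination A id ∘ₗ h, fun x hx => ?_⟩
  rw [LinearMap.comp_apply, hh x hx]
  exact LinearMap.congr_fun hs _

theorem Module.Baer.projective [IsNoetherianRing A] (hA : Module.Baer A A) {M : Type u}
    [AddCommGroup M] [Module A M] (hM : Module.Baer A M) : Module.Projective A M := by
  obtain ⟨ι, f, hf⟩ := hA.exists_injective_finsupp M
  obtain ⟨r, hr⟩ := hM.extension_property f hf LinearMap.id
  exact Module.Projective.of_split f r hr

theorem isQuasiFrobenius_iff :
    IsQuasiFrobenius A ↔ IsNoetherianRing A ∧ Module.Baer A A := by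
  refine ⟨fun h => ?_, fun ⟨_, hA⟩ P hP => ?_⟩
  · have hA := h.baer A
    exact ⟨(accLeftAnn_of_baer_finsupp (h.baer (ℕ →₀ A))).isNoetherianRing hA, hA⟩
  · have := (IsProjective.iff_projective (R := A) P).2 hP
    exact (hA.of_projective P).injective_moduleCat

theorem isQuasiFrobenius_mulOpposite_iff : IsQuasiFrobenius Aᵐᵒᵖ ↔ IsQuasiFrobenius A := by
  rw [isQuasiFrobenius_iff, isQuasiFrobenius_iff]
  constructor
  · rintro ⟨_, h⟩
    exact isNoetherianRing_and_baer_of_antiEquiv h MulOpposite.opAddEquiv fun _ _ => rfl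
  · rintro ⟨_, h⟩
    exact isNoetherianRing_and_baer_of_antiEquiv h MulOpposite.opAddEquiv.symm fun _ _ => rfl

theorem IsQuasiFrobenius.injective_iff (h : IsQuasiFrobenius A) (M : ModuleCat.{u} A) :
    CategoryTheory.Injective M ↔ Projective M := by
  refine ⟨fun hM => ?_, h M⟩
  obtain ⟨_, hA⟩ := isQuasiFrobenius_iff.1 h
  exact (IsProjective.iff_projective (R := A) M).1 (hA.projective (baer_of_injective_moduleCat hM))

theorem isCotorsionModule_of_injective {M : ModuleCat.{u} A} (hM : CategoryTheory.Injective M) :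
    IsCotorsionModule M := fun _ _ => Abelian.Ext.subsingleton_of_injective _ _ 0

theorem IsQuasiFrobenius.isFlatCotorsion_iff (h : IsQuasiFrobenius A) (M : ModuleCat.{u} A) :
    IsFlatCotorsion M ↔ Projective M := by
  obtain ⟨_, hA⟩ := isQuasiFrobenius_iff.1 h
  exact ⟨fun hM => (h.injective_iff M).1 (hM.1.baer hA).injective_moduleCat, fun hM =>
    ⟨isFlatModule_of_projective hM, isCotorsionModule_of_injective (h M hM)⟩⟩

end QuasiFrobenius

/-! ### Totally acyclic complexes -/

section Complexes

variable {A : Type u} [Ring A]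

theorem acyclic_iff_exact {F : ChainComplex (ModuleCat.{u} A) ℤ} :
    F.Acyclic ↔ ∀ n : ℤ, (F.sc' (n + 1 + 1) (n + 1) n).Exact := by
  have key : ∀ n : ℤ, F.ExactAt (n + 1) ↔ (F.sc' (n + 1 + 1) (n + 1) n).Exact := fun n =>
    F.exactAt_iff' _ _ _ (ComplexShape.prev_eq' _ rfl) (ComplexShape.next_eq' _ rfl)
  refine ⟨fun h n => (key n).1 (h _), fun h n => ?_⟩
  obtain ⟨m, rfl⟩ : ∃ m, n = m + 1 := ⟨n - 1, by omega⟩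
  exact (key m).2 (h m)

theorem homComplex_acyclic_iff {F : ChainComplex (ModuleCat.{u} A) ℤ} {C : ModuleCat.{u} A} :
    (homComplex F C).Acyclic ↔ ∀ (n : ℤ) (f : F.X (n + 1) ⟶ C), F.d (n + 1 + 1) (n + 1) ≫ f = 0 →
      ∃ g : F.X n ⟶ C, F.d (n + 1) n ≫ g = f := by
  have key : ∀ n : ℤ, (homComplex F C).ExactAt (n + 1) ↔
      ∀ f : F.X (n + 1) ⟶ C, F.d (n + 1 + 1) (n + 1) ≫ f = 0 →
      ∃ g : F.X n ⟶ C, F.d (n + 1) n ≫ g = f := fun n => by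
    rw [(homComplex F C).exactAt_iff' n (n + 1) (n + 1 + 1) (ComplexShape.prev_eq' _ rfl)
      (ComplexShape.next_eq' _ rfl), ShortComplex.ab_exact_iff]
    rfl
  refine ⟨fun h n => (key n).1 (h _), fun h n => ?_⟩
  obtain ⟨m, rfl⟩ : ∃ m, n = m + 1 := ⟨n - 1, by omega⟩
  exact (key m).2 (h m)

theorem homComplex_acyclic_of_injective {F : ChainComplex (ModuleCat.{u} A) ℤ} (hF : F.Acyclic)
    {C : ModuleCat.{u} A} (hC : CategoryTheory.Injective C) : (homComplex F C).Acyclic :=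
  homComplex_acyclic_iff.2 fun n f hf =>
    ⟨(acyclic_iff_exact.1 hF n).descToInjective f hf,
      (acyclic_iff_exact.1 hF n).comp_descToInjective f hf⟩

theorem IsGorensteinFor.of_iso {P : ModuleCat.{u} A → Prop} {G G' : ModuleCat.{u} A} (e : G ≅ G')
    (h : IsGorensteinFor P G) : IsGorensteinFor P G' := by
  obtain ⟨F, hF, ⟨e'⟩⟩ := h
  exact ⟨F, hF, ⟨e' ≪≫ e⟩⟩

/-- Dimension shifting along `0 → Z → F₀ → G → 0`: every map `Z → C` extends to `F₀` because
`Hom(F, C)` is acyclic, so `Ext¹(G, C)` embeds into `Ext¹(F₀, C)`. -/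
theorem IsGorensteinFor.subsingleton_ext {P : ModuleCat.{u} A → Prop} {G C : ModuleCat.{u} A}
    (hG : IsGorensteinFor P G) (hC : P C)
    (hP : ∀ F, P F → Subsingleton (Abelian.Ext F C 1)) : Subsingleton (Abelian.Ext G C 1) := by
  obtain ⟨F, hF, ⟨e⟩⟩ := hG
  let d := F.d 1 0
  let S : ShortComplex (ModuleCat.{u} A) :=
    ShortComplex.mk (Abelian.image.ι d) (cokernel.π d ≫ e.hom) (by
      rw [← Category.assoc, kernel.condition, zero_comp])
  have hS : S.ShortExact := by
    let S' : ShortComplex (ModuleCat.{u} A) :=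
      ShortComplex.mk (Abelian.image.ι d) (cokernel.π d) (kernel.condition _)
    have hS' : S'.Exact := S'.exact_of_f_is_kernel (kernelIsKernel _)
    let φ : S' ⟶ S := { τ₁ := 𝟙 _, τ₂ := 𝟙 _, τ₃ := e.hom }
    have : Epi φ.τ₁ := inferInstanceAs (Epi (𝟙 _))
    have : IsIso φ.τ₂ := inferInstanceAs (IsIso (𝟙 _))
    have : Mono φ.τ₃ := inferInstanceAs (Mono e.hom)
    exact .mk' ((ShortComplex.exact_iff_of_epi_of_isIso_of_mono φ).1 hS')
      (inferInstanceAs (Mono (Abelian.image.ι d)))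
      (inferInstanceAs (Epi (cokernel.π d ≫ e.hom)))
  refine subsingleton_of_forall_eq 0 fun x => ?_
  obtain ⟨y, hy⟩ := Abelian.Ext.contravariant_sequence_exact₃ hS C x
    ((hP _ (hF.mem 0)).elim _ _) (n₀ := 0) rfl
  obtain ⟨f, rfl⟩ := Abelian.Ext.homEquiv₀.symm.surjective y
  obtain ⟨g, hg⟩ := homComplex_acyclic_iff.1 (hF.hom_acyclic C hC) 0
    (Abelian.factorThruImage d ≫ f) (by
      have : F.d 2 1 ≫ Abelian.factorThruImage d = 0 := by
        rw [← cancel_mono (Abelian.image.ι d), Category.assoc, Abelian.image.fac, zero_comp]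
        exact F.d_comp_d 2 1 0
      change F.d 2 1 ≫ Abelian.factorThruImage d ≫ f = 0
      rw [← Category.assoc, this, zero_comp])
  have hfg : S.f ≫ g = f := by
    rw [← cancel_epi (Abelian.factorThruImage d), ← Category.assoc, Abelian.image.fac]
    exact hg
  rw [← hy, Abelian.Ext.homEquiv₀_symm_apply, ← hfg, ← Abelian.Ext.mk₀_comp_mk₀,
    hS.extClass_comp_assoc]

theorem injective_of_forall_isGorensteinFor {P : ModuleCat.{u} A → Prop}
    (hP : ∀ F C, P F → P C → Subsingleton (Abelian.Ext F C 1))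
    (h : ∀ G, IsGorensteinFor P G) {C : ModuleCat.{u} A} (hC : P C) :
    CategoryTheory.Injective C :=
  injective_iff_subsingleton_ext_one.2 fun {G} => (h G).subsingleton_ext hC fun F hF => hP F C hF hC

theorem isQuasiFrobenius_of_isGorensteinProjective
    (h : ∀ M : ModuleCat.{u} A, IsGorensteinProjective M) : IsQuasiFrobenius A := fun _ hP =>
  injective_of_forall_isGorensteinFor (P := fun P => Projective P)
    (fun _ _ _ _ => Abelian.Ext.subsingleton_of_projective _ _ 0) h hP

/-- All flat-cotorsion modules are injective by `injective_of_forall_isGorensteinFor`, and a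
projective module is a direct summand of the flat-cotorsion module of which it is a quotient. -/
theorem isQuasiFrobenius_of_isGorensteinFlatCotorsion
    (h : ∀ M : ModuleCat.{u} A, IsGorensteinFlatCotorsion M) : IsQuasiFrobenius A := fun P hP => by
  obtain ⟨F, hF, ⟨e⟩⟩ := h P
  have hinj : CategoryTheory.Injective (F.X 0) :=
    injective_of_forall_isGorensteinFor (fun F C hF hC => hC.2 F hF.1) h (hF.mem 0)
  let s := Projective.factorThru (𝟙 P) (cokernel.π (F.d 1 0) ≫ e.hom)
  exact Retract.injective ⟨s, cokernel.π (F.d 1 0) ≫ e.hom, Projective.factorThru_comp _ _⟩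

/-- A relation which is total in both directions has bi-infinite chains through every point. -/
theorem exists_int_chain {α : Type*} {R : α → α → Prop} (hl : ∀ y, ∃ x, R x y)
    (hr : ∀ x, ∃ y, R x y) (a : α) : ∃ Z : ℤ → α, Z 0 = a ∧ ∀ n, R (Z (n + 1)) (Z n) := by
  choose l hl using hl
  choose r hr using hr
  refine ⟨fun n => Int.rec (fun k => l^[k] a) (fun k => r^[k + 1] a) n, rfl, fun n => ?_⟩
  match n with
  | .ofNat k =>
    change R (l^[k + 1] a) (l^[k] a)
    rw [Function.iterate_succ_apply']
    exact hl _
  | .negSucc 0 => exact hr a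
  | .negSucc (k + 1) =>
    change R (r^[k + 1] a) (r^[k + 1 + 1] a)
    rw [Function.iterate_succ_apply' r (k + 1)]
    exact hr _

/-- If every module embeds into a projective one, then every module is the cokernel of `F₁ ⟶ F₀` for
an acyclic complex of projectives, spliced from short exact sequences with projective middle
terms. -/
theorem exists_acyclic_projective
    (hl : ∀ M : ModuleCat.{u} A, ∃ (P : ModuleCat.{u} A) (i : M ⟶ P), Projective P ∧ Mono i)
    (M : ModuleCat.{u} A) :
    ∃ F : ChainComplex (ModuleCat.{u} A) ℤ, (∀ n, Projective (F.X n)) ∧ F.Acyclic ∧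
      Nonempty (cokernel (F.d 1 0) ≅ M) := by
  obtain ⟨Z, rfl, hZ⟩ := exists_int_chain
    (R := fun X Y : ModuleCat.{u} A => ∃ S : ShortComplex (ModuleCat.{u} A), S.ShortExact ∧
      Projective S.X₂ ∧ S.X₁ = X ∧ S.X₃ = Y)
    (fun Y => ⟨_, ShortComplex.mk _ (Projective.π Y) (kernel.condition _),
      .mk' (ShortComplex.exact_of_f_is_kernel _ (kernelIsKernel _))
        (inferInstanceAs (Mono (kernel.ι _))) (inferInstanceAs (Epi (Projective.π Y))),
      inferInstanceAs (Projective (Projective.over Y)), rfl, rfl⟩)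
    (fun X => by
      obtain ⟨P, i, hP, hi⟩ := hl X
      exact ⟨_, ShortComplex.mk i _ (cokernel.condition _),
        .mk' (ShortComplex.exact_of_g_is_cokernel _ (cokernelIsCokernel _)) hi
          (inferInstanceAs (Epi (cokernel.π i))), hP, rfl, rfl⟩) M
  choose S hS hP h1 h3 using hZ
  let p : ∀ n, (S n).X₂ ⟶ Z n := fun n => (S n).g ≫ eqToHom (h3 n)
  let i : ∀ n, Z (n + 1) ⟶ (S n).X₂ := fun n => eqToHom (h1 n).symm ≫ (S n).f
  have hpe : ∀ n, Epi (p n) := fun n =>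
    have := (hS n).epi_g
    inferInstanceAs (Epi ((S n).g ≫ eqToHom (h3 n)))
  have him : ∀ n, Mono (i n) := fun n =>
    have := (hS n).mono_f
    inferInstanceAs (Mono (eqToHom (h1 n).symm ≫ (S n).f))
  have hip : ∀ n, i n ≫ p n = 0 := fun n => by simp [i, p]
  let T : ℤ → ShortComplex (ModuleCat.{u} A) := fun n => ShortComplex.mk (i n) (p n) (hip n)
  have hT : ∀ n, (T n).ShortExact := fun n => ShortComplex.shortExact_of_iso
    (ShortComplex.isoMk (eqToIso (h1 n)) (Iso.refl _) (eqToIso (h3 n)) (by simp [T, i])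
      (by simp [T, p])) (hS n)
  let d : ∀ n, (S (n + 1)).X₂ ⟶ (S n).X₂ := fun n => p (n + 1) ≫ i n
  have sq : ∀ n, d (n + 1) ≫ d n = 0 := fun n => by
    simp only [d, Category.assoc]
    rw [← Category.assoc (i (n + 1)), hip, zero_comp, comp_zero]
  let F : ChainComplex (ModuleCat.{u} A) ℤ := ChainComplex.of (fun n => (S n).X₂) d sq
  have hFd : ∀ n, F.d (n + 1) n = p (n + 1) ≫ i n := fun n =>
    ChainComplex.of_d (fun n => (S n).X₂) d n
  refine ⟨F, hP, acyclic_iff_exact.2 fun n => ?_, ⟨?_⟩⟩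
  · let U : ShortComplex (ModuleCat.{u} A) :=
      ShortComplex.mk (F.d (n + 1 + 1) (n + 1)) (p (n + 1)) (by
        rw [hFd, Category.assoc, hip, comp_zero])
    let φ : U ⟶ T (n + 1) :=
      { τ₁ := p (n + 1 + 1), τ₂ := 𝟙 _, τ₃ := 𝟙 _
        comm₁₂ := by
          simp only [U, T, hFd]
          exact (Category.comp_id _).symm
        comm₂₃ := (Category.id_comp _).trans (Category.comp_id _).symm }
    have : Epi φ.τ₁ := hpe _
    have : IsIso φ.τ₂ := inferInstanceAs (IsIso (𝟙 _))
    have : Mono φ.τ₃ := inferInstanceAs (Mono (𝟙 _))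
    have hU : U.Exact := (ShortComplex.exact_iff_of_epi_of_isIso_of_mono φ).2 (hT _).exact
    let ψ : U ⟶ F.sc' (n + 1 + 1) (n + 1) n :=
      { τ₁ := 𝟙 _, τ₂ := 𝟙 _, τ₃ := i n
        comm₁₂ := (Category.id_comp _).trans (Category.comp_id _).symm
        comm₂₃ := (Category.id_comp _).trans (hFd n) }
    have : Epi ψ.τ₁ := inferInstanceAs (Epi (𝟙 _))
    have : IsIso ψ.τ₂ := inferInstanceAs (IsIso (𝟙 _))
    have : Mono ψ.τ₃ := him n
    exact (ShortComplex.exact_iff_of_epi_of_isIso_of_mono ψ).1 hU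
  · have := (hT 0).epi_g
    exact cokernelIsoOfEq (hFd 0) ≪≫ cokernelEpiComp (p (0 + 1)) (i 0) ≪≫
      (cokernelIsCokernel (i 0)).coconePointUniqueUpToIso (hT 0).gIsCokernel

/-- Every module embeds into an injective, hence projective, module, so it is a cokernel in an
acyclic complex of projectives; the complex stays acyclic under `Hom(-, C)` for projective `C`
because `C` is injective. -/
theorem IsQuasiFrobenius.isGorensteinProjective (h : IsQuasiFrobenius A) (M : ModuleCat.{u} A) :
    IsGorensteinProjective M := by
  obtain ⟨F, hF, hac, e⟩ := exists_acyclic_projective (fun M => ⟨Injective.under M, Injective.ι M,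
    (h.injective_iff _).1 inferInstance, inferInstance⟩) M
  exact ⟨F, ⟨hF, hac, fun C hC => homComplex_acyclic_of_injective hac (h C hC)⟩, e⟩

theorem IsQuasiFrobenius.isGorensteinFlatCotorsion (h : IsQuasiFrobenius A)
    (M : ModuleCat.{u} A) : IsGorensteinFlatCotorsion M := by
  have : (IsFlatCotorsion : ModuleCat.{u} A → Prop) = fun P => Projective P :=
    funext fun M => propext (h.isFlatCotorsion_iff M)
  rw [IsGorensteinFlatCotorsion, this]
  exact h.isGorensteinProjective M

theorem isGorensteinProjective_of_isZero {M : ModuleCat.{u} A} (hM : IsZero M) :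
    IsGorensteinProjective M := by
  let F : ChainComplex (ModuleCat.{u} A) ℤ :=
    ChainComplex.of (fun _ => M) (fun _ => 0) fun _ => zero_comp
  have h0 : ∀ n, IsZero (F.X n) := fun _ => hM
  exact ⟨F, ⟨fun n => (h0 n).projective, fun n => .of_isZero (h0 n), fun C _ =>
    homComplex_acyclic_iff.2 fun n f _ => ⟨0, (h0 _).eq_of_src _ _⟩⟩,
    ⟨(IsZero.of_epi (cokernel.π (F.d 1 0)) (h0 0)).iso hM⟩⟩

theorem hasGorensteinProjectiveResolution_zero_iff {M : ModuleCat.{u} A} :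
    HasGorensteinProjectiveResolution M 0 ↔ IsGorensteinProjective M := by
  refine ⟨fun ⟨G, π, hG, h0, hπ⟩ => ?_, fun h => ?_⟩
  · have hq := (ChainComplex.quasiIsoAt₀_iff π).1 inferInstance
    have hd : G.d 1 0 = 0 := (h0 1 one_pos).eq_of_src _ _
    have hs : ∀ j, ((ChainComplex.single₀ _).obj M).d 0 j = 0 := fun j =>
      HomologicalComplex.single_obj_d (ComplexShape.down ℕ) 0 M 0 j
    obtain ⟨hex, hmono⟩ := (ShortComplex.quasiIso_iff_of_zeros _ hd (G.shape _ _ (by simp))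
      (HomologicalComplex.single_obj_d (ComplexShape.down ℕ) 0 M 1 0)).1 hq
    have hepi := hex.epi_f (hs 0)
    have : Mono (π.f 0) := hmono
    have : Epi (π.f 0) := hepi
    have : IsIso (π.f 0) := isIso_of_mono_of_epi _
    let e := asIso (π.f 0)
    exact (hG 0).of_iso e
  · refine ⟨(ChainComplex.single₀ _).obj M, 𝟙 _, fun i => ?_, fun i hi => ?_, inferInstance⟩
    · rcases i with _ | i
      · exact h
      · exact isGorensteinProjective_of_isZero
          (HomologicalComplex.isZero_single_obj_X _ _ _ _ (by simp))
    · exact HomologicalComplex.isZero_single_obj_X _ _ _ _ hi.ne'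

theorem gorensteinGlobalDim_eq_zero_iff :
    gorensteinGlobalDim A = 0 ↔ ∀ M : ModuleCat.{u} A, IsGorensteinProjective M := by
  rw [gorensteinGlobalDim, ← bot_eq_zero, iSup_eq_bot]
  refine forall_congr' fun M => ?_
  rw [← hasGorensteinProjectiveResolution_zero_iff, gorensteinProjectiveDim, bot_eq_zero]
  simp [ENat.iInf_eq_zero]

end Complexes

theorem gorensteinGlobalDim_eq_zero_iff_isQuasiFrobenius (A : Type u) [Ring A] :
    gorensteinGlobalDim A = 0 ↔ IsQuasiFrobenius A :=
  gorensteinGlobalDim_eq_zero_iff.trans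
    ⟨isQuasiFrobenius_of_isGorensteinProjective, IsQuasiFrobenius.isGorensteinProjective⟩

theorem forall_isGorensteinFlatCotorsion_iff_isQuasiFrobenius (A : Type u) [Ring A] :
    (∀ M : ModuleCat.{u} A, IsGorensteinFlatCotorsion M) ↔ IsQuasiFrobenius A :=
  ⟨isQuasiFrobenius_of_isGorensteinFlatCotorsion, IsQuasiFrobenius.isGorensteinFlatCotorsion⟩

theorem mainTheorem3 (A : Type u) [Ring A] :
    List.TFAE [
      gorensteinGlobalDim A = 0,
      gorensteinGlobalDim Aᵐᵒᵖ = 0,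
      ∀ M : ModuleCat.{u} A, IsGorensteinFlatCotorsion M,
      ∀ M : ModuleCat.{u} Aᵐᵒᵖ, IsGorensteinFlatCotorsion M,
      IsQuasiFrobenius A] := by
  rw [gorensteinGlobalDim_eq_zero_iff_isQuasiFrobenius,
    gorensteinGlobalDim_eq_zero_iff_isQuasiFrobenius,
    forall_isGorensteinFlatCotorsion_iff_isQuasiFrobenius,
    forall_isGorensteinFlatCotorsion_iff_isQuasiFrobenius, isQuasiFrobenius_mulOpposite_iff]
  simp
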